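/- Permutability theorem. Let $U\subset\mathbb R^3$ be open and connected. A triply orthogonal system on $U$ is a smooth map $f:U\to\mathbb R^3$ with $\det(\partial_1f,\partial_2f,\partial_3f)\neq0$ and $(\partial_if,\partial_jf)=0$ for $i\ne j$. For cyclic permutations $(i,j,k)$ of $(1,2,3)$ let $N_i=\frac{\partial_jf\times\partial_kf}{|\partial_jf\times\partial_kf|}$ be its unit normals, define the Lamé coefficients $H_i$ by $\partial_if=H_iN_i$, and for $i\neq j$ let $\kappa_{ij}=-\frac{\partial_iH_j}{H_iH_j}$ be the principal curvatures of the coordinate surfaces $x_i=\mathrm{const}$. Put $(\varepsilon_1,\varepsilon_2,\varepsilon_3)=(1,1,-1)$. For a function $\chi$, the system is a $\chi$-system if $\sum_i\varepsilon_iH_i^2=\chi$; a Guichard net is a $0$-system. A Combescure transform of $f$ is a smooth map $g:U\to\mathbb R^3$ (possibly degenerate) with $\partial_ig=h_i\,\partial_if$ for some functions $h_1,h_2,h_3$. Let $f$ be a Guichard net. An associated system $\hat f$ of $f$ is a Combescure transform of $f$ given by functions $h_i$ with $$\partial_1h_3=-\tfrac{H_2}{H_3}\kappa_{13},\quad \partial_2h_3=\tfrac{H_1}{H_3}\kappa_{23},\quad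 \partial_3h_3=-\tfrac{H_1H_2}{H_3^2}(\kappa_{31}-\kappa_{32}),\quad h_1=h_3+\tfrac{H_2}{H_1H_3},\quad h_2=h_3-\tfrac{H_1}{H_2H_3};$$ the dual system $f^\star$ with respect to $\hat f$ is a Combescure transform of $f$ given by the functions $-h_i^2+\varepsilon_i/H_i^2$. A family $(\hat f_c)_{c\in\mathbb R}$ of associated systems of $f$ is one with $\hat f_c=\hat f_0+cf$, and the corresponding family of dual systems consists of duals $f^\star_c$ with respect to $\hat f_c$ with $f^\star_c=f^\star_0-2c\hat f_0-c^2f$. Let $(\hat f_c)$ and $(f_c^\star)$ be such families for $f$. Let $\alpha\neq0$ and let $\bar f$ be a Combescure transform of $f$ that is an $\alpha^2|\bar f|^2$-system with $\bar f\ne0$ on $U$. For a Combescure transform $g$ of $f$ write $\partial_ig=G_iN_i$ and $\partial_i\bar f=\bar H_iN_i$ with respect to the common unit normals $N_i$ of $\bar f$, and let the Bäcklund-type transform of $g$ induced by $\bar f$ be $$\mathcal R(g)=g-\frac{2\varphi_g}{|\bar f|^2}\,\bar f,\qquad \varphi_g=\frac1{\alpha^2}\left(G_1\bar H_1+G_2\bar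 H_2-G_3\bar H_3\right).$$ Assume that $\mathcal R(f)$ is nondegenerate, i.e. $\det(\partial_1\mathcal R(f),\partial_2\mathcal R(f),\partial_3\mathcal R(f))\neq0$ on $U$. Then $\mathcal R(f)$ is a Guichard net, $(\mathcal R(\hat f_c))_c$ is a family of associated systems of $\mathcal R(f)$, and $(\mathcal R(f^\star_c))_c$ is the corresponding family of dual systems: $$\mathcal R(\hat f_c)=\widehat{\mathcal R(f)}_c\quad\text{and}\quad \mathcal R(f^\star_c)=\mathcal R(f)^\star_c\qquad(c\in\mathbb R).$$ -/

import Mathlib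

open scoped ContDiff

noncomputable section

namespace GuichardNets

/-- Euclidean 3-space, used both for the coordinates `(x, y, z)` and for the ambient space. -/
abbrev R3 : Type := EuclideanSpace ℝ (Fin 3)

/-- The partial derivative `∂_i g` at `x`; the indices 1, 2, 3 of the text are `0, 1, 2 : Fin 3`. -/
def pd {F : Type*} [NormedAddCommGroup F] [NormedSpace ℝ F] (i : Fin 3) (g : R3 → F) (x : R3) : F :=
  fderiv ℝ g x (EuclideanSpace.single i 1)

/-- The Jacobian determinant `det (∂_x f, ∂_y f, ∂_z f)`. -/
def jacDet (f : R3 → R3) (x : R3) : ℝ :=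
  (Matrix.of fun a b : Fin 3 => pd b f x a).det

/-- The cross product of two vectors of Euclidean 3-space. -/
def cross (a b : R3) : R3 :=
  WithLp.toLp 2 (crossProduct (WithLp.ofLp a) (WithLp.ofLp b))

/-- The unit normal `N_i = (∂_j f × ∂_k f) / |∂_j f × ∂_k f|` of the coordinate surface
`x_i = const`, where `(i, j, k)` is a cyclic permutation of the indices: addition in `Fin 3` is
modulo 3. -/
def unitNormal (f : R3 → R3) (i : Fin 3) (x : R3) : R3 :=
  ‖cross (pd (i + 1) f x) (pd (i + 2) f x)‖⁻¹ • cross (pd (i + 1) f x) (pd (i + 2) f x)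

/-- The coefficient `G_i` in `∂_i g = G_i N_i`, where `N_i` are the unit normals of the system `f`.
It is used for a Combescure transform `g` of `f`, whose partial derivative `∂_i g` is a multiple
of `N_i`. -/
def lameWrt (f g : R3 → R3) (i : Fin 3) (x : R3) : ℝ :=
  inner ℝ (pd i g x) (unitNormal f i x)

/-- The Lamé coefficient `H_i` of `f`, that is `∂_i f = H_i N_i`. -/
def lame (f : R3 → R3) (i : Fin 3) (x : R3) : ℝ :=
  lameWrt f f i x

/-- Darboux's rotational coefficient `β_ij = ∂_i H_j / H_i`. -/
def rotCoeff (f : R3 → R3) (i j : Fin 3) (x : R3) : ℝ :=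
  pd i (lame f j) x / lame f i x

/-- The principal curvature `κ_ij = - β_ij / H_j` of the coordinate surfaces `x_i = const`. -/
def princCurv (f : R3 → R3) (i j : Fin 3) (x : R3) : ℝ :=
  -(rotCoeff f i j x) / lame f j x

/-- The signs `(ε_1, ε_2, ε_3) = (1, 1, -1)`. -/
def eps : Fin 3 → ℝ := ![1, 1, -1]

/-- `f` is a (smooth) triply orthogonal system on `U`. -/
structure IsTriplyOrthogonal (U : Set R3) (f : R3 → R3) : Prop where
  smooth : ContDiffOn ℝ ∞ f U
  jacDet_ne_zero : ∀ x ∈ U, jacDet f x ≠ 0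
  orthogonal : ∀ x ∈ U, ∀ i j : Fin 3, i ≠ j → inner ℝ (pd i f x) (pd j f x) = 0

/-- `f` is a `χ`-system on `U`: a triply orthogonal system with `H_1² + H_2² - H_3² = χ`. -/
structure IsChiSystem (U : Set R3) (χ : R3 → ℝ) (f : R3 → R3) : Prop where
  triplyOrthogonal : IsTriplyOrthogonal U f
  trace_eq : ∀ x ∈ U, lame f 0 x ^ 2 + lame f 1 x ^ 2 - lame f 2 x ^ 2 = χ x

/-- A Guichard net is a `0`-system. -/
def IsGuichardNet (U : Set R3) (f : R3 → R3) : Prop :=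
  IsChiSystem U (fun _ => 0) f

/-- `dg = h_1 ∂_x f dx + h_2 ∂_y f dy + h_3 ∂_z f dz` on `U`, with `g` smooth. The functions `h_i`
may have zeros, so that `g` is allowed to degenerate. -/
structure IsCombescureWith (U : Set R3) (f g : R3 → R3) (h : Fin 3 → R3 → ℝ) : Prop where
  smooth : ContDiffOn ℝ ∞ g U
  pd_eq : ∀ x ∈ U, ∀ i : Fin 3, pd i g x = h i x • pd i f x

/-- `g` is a Combescure transform of `f` on `U`. -/
def IsCombescure (U : Set R3) (f g : R3 → R3) : Prop :=
  ∃ h : Fin 3 → R3 → ℝ, IsCombescureWith U f g h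

/-- The system that the functions `h_1, h_2, h_3` inducing an associated system of the Guichard
net `f` satisfy. -/
structure IsAssociatedData (U : Set R3) (f : R3 → R3) (h : Fin 3 → R3 → ℝ) : Prop where
  pd_x : ∀ x ∈ U, pd 0 (h 2) x = -(lame f 1 x / lame f 2 x) * princCurv f 0 2 x
  pd_y : ∀ x ∈ U, pd 1 (h 2) x = lame f 0 x / lame f 2 x * princCurv f 1 2 x
  pd_z : ∀ x ∈ U, pd 2 (h 2) x =
    -(lame f 0 x * lame f 1 x / lame f 2 x ^ 2) * (princCurv f 2 0 x - princCurv f 2 1 x)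
  h_one : ∀ x ∈ U, h 0 x = h 2 x + lame f 1 x / (lame f 0 x * lame f 2 x)
  h_two : ∀ x ∈ U, h 1 x = h 2 x - lame f 0 x / (lame f 1 x * lame f 2 x)

/-- `g` is an associated system of the Guichard net `f`. -/
def IsAssociated (U : Set R3) (f g : R3 → R3) : Prop :=
  ∃ h : Fin 3 → R3 → ℝ, IsCombescureWith U f g h ∧ IsAssociatedData U f h

/-- `d` is the dual system of the Guichard net `f` with respect to the associated system `g`: if
`g` is induced by the functions `h_i`, then `d` is induced by `- h_i² + ε_i / H_i²`. -/
def IsDual (U : Set R3) (f g d : R3 → R3) : Prop :=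
  ∃ h : Fin 3 → R3 → ℝ, IsCombescureWith U f g h ∧ IsAssociatedData U f h ∧
    IsCombescureWith U f d fun i x => -(h i x) ^ 2 + eps i / lame f i x ^ 2

/-- `A` is the 1-parameter family `A c = A 0 + c f` of associated systems of `f`. -/
structure IsAssociatedFamily (U : Set R3) (f : R3 → R3) (A : ℝ → R3 → R3) : Prop where
  isAssociated : ∀ c, IsAssociated U f (A c)
  eq_add : ∀ c, ∀ x ∈ U, A c x = A 0 x + c • f x

/-- `D` is the 1-parameter family `D c = D 0 - 2 c A 0 - c² f` of dual systems of `f` that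
corresponds to the family `A` of associated systems. -/
structure IsDualFamily (U : Set R3) (f : R3 → R3) (A D : ℝ → R3 → R3) : Prop where
  isDual : ∀ c, IsDual U f (A c) (D c)
  eq_sub : ∀ c, ∀ x ∈ U, D c x = D 0 x - (2 * c) • A 0 x - c ^ 2 • f x

/-- The function `φ = (G_1 H̄_1 + G_2 H̄_2 - G_3 H̄_3) / α²`, where `H̄_i` and `G_i` are the
coefficients of `fbar` and of its Combescure transform `g` with respect to their common unit
normals. -/
def backlundPhi (α : ℝ) (fbar g : R3 → R3) (x : R3) : ℝ :=
  1 / α ^ 2 * (lameWrt fbar g 0 x * lame fbar 0 x + lameWrt fbar g 1 x * lame fbar 1 x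
    - lameWrt fbar g 2 x * lame fbar 2 x)

/-- The Bäcklund-type transform `R(g) = g - (2 φ / |fbar|²) fbar` of `g` induced by the
`α² |fbar|²`-system `fbar`. -/
def backlund (α : ℝ) (fbar g : R3 → R3) (x : R3) : R3 :=
  g x - (2 * backlundPhi α fbar g x / ‖fbar x‖ ^ 2) • fbar x

end GuichardNets

end

open GuichardNets

open scoped Topology

/-! At each point, a Combescure transform of `f` with coefficients `p` gives the vector `(p i *
H_i)` of the Lorentz space with metric `diag(1, 1, -1)`; `traceForm` is the resulting product. The
transform acts by two reflections at once: the tangent directions `∂_i f` are reflected in `fbar` in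
Euclidean space, and the vector of `g` is reflected in the vector of `fbar` in Lorentz space
(`BacklundPair.pd_backlund`).

The differential input is `pd_traceForm`. It gives a zero `traceDefect` for every `g` whose product
with `f` is constant, and `traceDefect f q i = α² (∂_i f, fbar)` for `fbar`. Hence the derivative of
the reflection coefficient is exactly the one that turns `∂_i R(g)` into a multiple of the reflected
`∂_i f`.

What remains is algebra invariant under the Lorentz reflection. The Guichard condition says that the
vector of `f` is lightlike. The formulas for `h_1`, `h_2` describe a cross product
(`reflected_cross`), and the differential equations for `h_3` follow from them
(`IsGuichardNet.isAssociatedData`). The vectors F, G, D of a net, an associated system and the dual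
satisfy the completeness relation `F ⊗ D + D ⊗ F + 2 G ⊗ G = 2 diag(1, 1, -1)`
(`reflected_completeness`). The formulas in `c` are preserved because the transform is linear in
`g`. -/

namespace GuichardNets

/-! ### Calculus of partial derivatives. -/

section PartialDerivatives

variable {F : Type*} [NormedAddCommGroup F] [NormedSpace ℝ F] {U : Set R3}

theorem contDiffOn_pd (hU : IsOpen U) {g : R3 → F} (hg : ContDiffOn ℝ ∞ g U) (i : Fin 3) :
    ContDiffOn ℝ ∞ (pd i g) U :=
  (hg.fderiv_of_isOpen hU (by simp)).clm_apply contDiffOn_const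

theorem differentiableAt_of_contDiffOn (hU : IsOpen U) {g : R3 → F} (hg : ContDiffOn ℝ ∞ g U)
    {x : R3} (hx : x ∈ U) : DifferentiableAt ℝ g x :=
  (hg.contDiffAt (hU.mem_nhds hx)).differentiableAt (by simp)

theorem pd_congr (hU : IsOpen U) {g k : R3 → F} (h : ∀ x ∈ U, g x = k x) {x : R3} (hx : x ∈ U)
    (i : Fin 3) : pd i g x = pd i k x := by
  have : g =ᶠ[𝓝 x] k := Filter.eventuallyEq_of_mem (hU.mem_nhds hx) h
  rw [pd, pd, this.fderiv_eq]

theorem pd_comm (hU : IsOpen U) {g : R3 → F} (hg : ContDiffOn ℝ ∞ g U) {x : R3} (hx : x ∈ U)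
    (i j : Fin 3) : pd i (pd j g) x = pd j (pd i g) x := by
  have hd : DifferentiableAt ℝ (fderiv ℝ g) x :=
    differentiableAt_of_contDiffOn hU (hg.fderiv_of_isOpen hU (by simp)) hx
  have key : ∀ a b : Fin 3, pd a (pd b g) x =
      fderiv ℝ (fderiv ℝ g) x (EuclideanSpace.single a 1) (EuclideanSpace.single b 1) := by
    intro a b
    have := fderiv_clm_apply hd (differentiableAt_const (EuclideanSpace.single b (1 : ℝ)))
    unfold pd
    rw [this]
    simp
  rw [key, key]
  exact ((hg.contDiffAt (hU.mem_nhds hx)).isSymmSndFDerivAt (by simp only [minSmoothness_of_isRCLikeNormedField]; exact WithTop.coe_le_coe.2 le_top)) _ _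

theorem pd_smul_fun {c : R3 → ℝ} {g : R3 → F} {x : R3} (hc : DifferentiableAt ℝ c x)
    (hg : DifferentiableAt ℝ g x) (i : Fin 3) :
    pd i (fun y => c y • g y) x = c x • pd i g x + pd i c x • g x := by
  simp [pd, fderiv_fun_smul hc hg]

theorem pd_mul_fun {c d : R3 → ℝ} {x : R3} (hc : DifferentiableAt ℝ c x)
    (hd : DifferentiableAt ℝ d x) (i : Fin 3) :
    pd i (fun y => c y * d y) x = c x * pd i d x + d x * pd i c x := by
  simp [pd, fderiv_fun_mul hc hd]

theorem pd_sub_fun {g k : R3 → F} {x : R3} (hg : DifferentiableAt ℝ g x)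
    (hk : DifferentiableAt ℝ k x) (i : Fin 3) :
    pd i (fun y => g y - k y) x = pd i g x - pd i k x := by
  simp [pd, fderiv_fun_sub hg hk]

theorem pd_add_fun {g k : R3 → F} {x : R3} (hg : DifferentiableAt ℝ g x)
    (hk : DifferentiableAt ℝ k x) (i : Fin 3) :
    pd i (fun y => g y + k y) x = pd i g x + pd i k x := by
  simp [pd, fderiv_fun_add hg hk]

theorem pd_const_mul {c : R3 → ℝ} {x : R3} (hc : DifferentiableAt ℝ c x) (a : ℝ) (i : Fin 3) :
    pd i (fun y => a * c y) x = a * pd i c x := by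
  simp [pd, fderiv_const_mul hc]

theorem pd_const_smul {g : R3 → F} {x : R3} (hg : DifferentiableAt ℝ g x) (a : ℝ) (i : Fin 3) :
    pd i (fun y => a • g y) x = a • pd i g x := by
  simp [pd, fderiv_fun_const_smul hg]

theorem pd_const (a : F) (x : R3) (i : Fin 3) : pd i (fun _ : R3 => a) x = 0 := by
  simp [pd]

theorem pd_inner {g k : R3 → R3} {x : R3} (hg : DifferentiableAt ℝ g x)
    (hk : DifferentiableAt ℝ k x) (i : Fin 3) :
    pd i (fun y => inner ℝ (g y) (k y)) x
      = inner ℝ (g x) (pd i k x) + inner ℝ (pd i g x) (k x) :=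
  fderiv_inner_apply ℝ hg hk _

end PartialDerivatives

/-! ### Triple products and reflections in Euclidean 3-space. -/

section VectorAlgebra

/-- The determinant of the matrix with the columns `a`, `b`, `c`. -/
noncomputable def tripleDet (a b c : R3) : ℝ := inner ℝ a (cross b c)

theorem tripleDet_eq (a b c : R3) : tripleDet a b c =
    a 0 * (b 1 * c 2 - b 2 * c 1) + a 1 * (b 2 * c 0 - b 0 * c 2)
      + a 2 * (b 0 * c 1 - b 1 * c 0) := by
  simp [tripleDet, cross, cross_apply, PiLp.inner_apply, Fin.sum_univ_three]
  ring

theorem inner_eq (a b : R3) : inner ℝ a b = a 0 * b 0 + a 1 * b 1 + a 2 * b 2 := by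
  simp [PiLp.inner_apply, Fin.sum_univ_three]
  ring

theorem jacDet_eq (f : R3 → R3) (x : R3) :
    jacDet f x = tripleDet (pd 0 f x) (pd 1 f x) (pd 2 f x) := by
  rw [tripleDet_eq, jacDet, Matrix.det_fin_three]
  simp
  ring

theorem tripleDet_rotate (a b c : R3) : tripleDet b c a = tripleDet a b c := by
  simp only [tripleDet_eq]; ring

theorem jacDet_eq_rotate (f : R3 → R3) (x : R3) (i : Fin 3) :
    jacDet f x = tripleDet (pd i f x) (pd (i + 1) f x) (pd (i + 2) f x) := by
  rw [jacDet_eq]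
  fin_cases i
  · rfl
  · exact (tripleDet_rotate _ _ _).symm
  · exact tripleDet_rotate _ _ _

theorem norm_cross_sq (a b : R3) :
    ‖cross a b‖ ^ 2 = inner ℝ a a * inner ℝ b b - inner ℝ a b ^ 2 := by
  rw [← real_inner_self_eq_norm_sq]
  simp only [inner_eq, cross, cross_apply]
  simp
  ring

theorem tripleDet_sq {a b c : R3} (hab : inner ℝ a b = 0) (hbc : inner ℝ b c = 0)
    (hac : inner ℝ a c = 0) :
    tripleDet a b c ^ 2 = inner ℝ a a * inner ℝ b b * inner ℝ c c := by
  have key : tripleDet a b c ^ 2 = inner ℝ a a * inner ℝ b b * inner ℝ c c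
      + 2 * inner ℝ a b * inner ℝ b c * inner ℝ a c - inner ℝ a a * inner ℝ b c ^ 2
      - inner ℝ b b * inner ℝ a c ^ 2 - inner ℝ c c * inner ℝ a b ^ 2 := by
    simp only [tripleDet_eq, inner_eq]; ring
  rw [key, hab, hbc, hac]; ring

/-- The reflection of `v` in the plane orthogonal to `w`. -/
noncomputable def reflect (w v : R3) : R3 := v - (2 * inner ℝ v w / ‖w‖ ^ 2) • w

theorem inner_reflect {w : R3} (hw : w ≠ 0) (u v : R3) :
    inner ℝ (reflect w u) (reflect w v) = inner ℝ u v := by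
  have hn : ‖w‖ ^ 2 ≠ 0 := by simpa using hw
  simp only [reflect, inner_sub_left, inner_sub_right, inner_smul_left, inner_smul_right,
    real_inner_self_eq_norm_sq, real_inner_comm w, conj_trivial]
  field_simp
  ring

theorem tripleDet_reflect {w : R3} (hw : w ≠ 0) (a b c : R3) :
    tripleDet (reflect w a) (reflect w b) (reflect w c) = -tripleDet a b c := by
  have hn : ‖w‖ ^ 2 ≠ 0 := by simpa using hw
  -- Cramer's rule for the expansion of `w` in `a`, `b`, `c`, paired with `w`.
  have h1 : inner ℝ a w * tripleDet w b c + inner ℝ b w * tripleDet a w c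
      + inner ℝ c w * tripleDet a b w = ‖w‖ ^ 2 * tripleDet a b c := by
    rw [← real_inner_self_eq_norm_sq]
    simp only [tripleDet_eq, inner_eq]; ring
  have h2 : ∀ r s t : ℝ, tripleDet (a - r • w) (b - s • w) (c - t • w) = tripleDet a b c
      - r * tripleDet w b c - s * tripleDet a w c - t * tripleDet a b w := by
    intro r s t
    simp only [tripleDet_eq, PiLp.sub_apply, PiLp.smul_apply, smul_eq_mul]; ring
  rw [reflect, reflect, reflect, h2]
  field_simp
  linear_combination -2 * h1

theorem tripleDet_smul (r s t : ℝ) (a b c : R3) :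
    tripleDet (r • a) (s • b) (t • c) = r * s * t * tripleDet a b c := by
  simp only [tripleDet_eq, PiLp.smul_apply, smul_eq_mul]; ring

end VectorAlgebra

variable {U : Set R3} {f g k d fbar : R3 → R3} {α : ℝ} {p q : Fin 3 → R3 → ℝ} {x : R3}

/-! ### Lamé coefficients of a triply orthogonal system. -/

section Lame

theorem IsTriplyOrthogonal.pd_ne_zero (hf : IsTriplyOrthogonal U f) (hx : x ∈ U) (i : Fin 3) :
    pd i f x ≠ 0 := by
  intro h
  apply hf.jacDet_ne_zero x hx
  rw [jacDet_eq_rotate f x i, h, tripleDet, inner_zero_left]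

theorem IsTriplyOrthogonal.inner_pos (hf : IsTriplyOrthogonal U f) (hx : x ∈ U) (i : Fin 3) :
    0 < inner ℝ (pd i f x) (pd i f x) :=
  real_inner_self_pos.2 (hf.pd_ne_zero hx i)

theorem IsTriplyOrthogonal.jacDet_sq (hf : IsTriplyOrthogonal U f) (hx : x ∈ U) :
    jacDet f x ^ 2 = inner ℝ (pd 0 f x) (pd 0 f x) * inner ℝ (pd 1 f x) (pd 1 f x)
      * inner ℝ (pd 2 f x) (pd 2 f x) := by
  rw [jacDet_eq, tripleDet_sq] <;> exact hf.orthogonal x hx _ _ (by decide)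

theorem IsTriplyOrthogonal.norm_cross_sq (hf : IsTriplyOrthogonal U f) (hx : x ∈ U) (i : Fin 3) :
    ‖cross (pd (i + 1) f x) (pd (i + 2) f x)‖ ^ 2
      = inner ℝ (pd (i + 1) f x) (pd (i + 1) f x)
        * inner ℝ (pd (i + 2) f x) (pd (i + 2) f x) := by
  rw [GuichardNets.norm_cross_sq, hf.orthogonal x hx (i + 1) (i + 2) (by revert i; decide)]
  ring

theorem IsTriplyOrthogonal.cross_ne_zero (hf : IsTriplyOrthogonal U f) (hx : x ∈ U) (i : Fin 3) :
    cross (pd (i + 1) f x) (pd (i + 2) f x) ≠ 0 := by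
  have h := mul_pos (hf.inner_pos hx (i + 1)) (hf.inner_pos hx (i + 2))
  rw [← hf.norm_cross_sq hx i] at h
  intro h0
  simp [h0] at h

theorem lame_eq (f : R3 → R3) (i : Fin 3) (x : R3) :
    lame f i x = ‖cross (pd (i + 1) f x) (pd (i + 2) f x)‖⁻¹ * jacDet f x := by
  rw [lame, lameWrt, unitNormal, inner_smul_right, jacDet_eq_rotate f x i, tripleDet]

theorem lameWrt_eq {c : ℝ} {i : Fin 3} (h : pd i g x = c • pd i f x) :
    lameWrt f g i x = c * lame f i x := by
  simp [lame, lameWrt, h, inner_smul_left]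

theorem IsTriplyOrthogonal.lame_sq (hf : IsTriplyOrthogonal U f) (hx : x ∈ U) (i : Fin 3) :
    lame f i x ^ 2 = inner ℝ (pd i f x) (pd i f x) := by
  have h : jacDet f x ^ 2 = inner ℝ (pd i f x) (pd i f x)
      * (inner ℝ (pd (i + 1) f x) (pd (i + 1) f x)
        * inner ℝ (pd (i + 2) f x) (pd (i + 2) f x)) := by
    rw [hf.jacDet_sq hx]
    fin_cases i <;> simp <;> ring
  rw [lame_eq, mul_pow, inv_pow, hf.norm_cross_sq hx, h]
  have h1 := (hf.inner_pos hx (i + 1)).ne'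
  have h2 := (hf.inner_pos hx (i + 2)).ne'
  field_simp

theorem IsTriplyOrthogonal.lame_ne_zero (hf : IsTriplyOrthogonal U f) (hx : x ∈ U) (i : Fin 3) :
    lame f i x ≠ 0 := by
  have h := (hf.inner_pos hx i).ne'
  rw [← hf.lame_sq hx] at h
  exact fun h0 => h (by simp [h0])

/-- The squares of the Lamé coefficients lose their signs; this product retains the orientation,
which is all that the formulas for `h_1` and `h_2` need. -/
theorem IsTriplyOrthogonal.lame_prod (hf : IsTriplyOrthogonal U f) (hx : x ∈ U) :
    lame f 0 x * lame f 1 x * lame f 2 x = jacDet f x := by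
  have hD := hf.jacDet_ne_zero x hx
  have hsq := hf.jacDet_sq hx
  have h0 := hf.norm_cross_sq hx 0
  have h1 := hf.norm_cross_sq hx 1
  have h2 := hf.norm_cross_sq hx 2
  rw [lame_eq, lame_eq, lame_eq]
  have e1 : (1 : Fin 3) + 1 = 2 := rfl
  have e2 : (1 : Fin 3) + 2 = 0 := rfl
  have e3 : (2 : Fin 3) + 1 = 0 := rfl
  have e4 : (2 : Fin 3) + 2 = 1 := rfl
  simp only [zero_add, e1, e2, e3, e4] at h0 h1 h2 ⊢
  generalize hn0 : ‖cross (pd 1 f x) (pd 2 f x)‖ = n0 at *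
  generalize hn1 : ‖cross (pd 2 f x) (pd 0 f x)‖ = n1 at *
  generalize hn2 : ‖cross (pd 0 f x) (pd 1 f x)‖ = n2 at *
  have p0 : 0 ≤ n0 := hn0 ▸ norm_nonneg _
  have p1 : 0 ≤ n1 := hn1 ▸ norm_nonneg _
  have p2 : 0 ≤ n2 := hn2 ▸ norm_nonneg _
  -- Both sides are nonnegative, and their squares equal the squared product of the three `(∂_i f,
  -- ∂_i f)`.
  have hprod : n0 * n1 * n2 = jacDet f x ^ 2 := by
    refine (pow_left_inj₀ (by positivity) (by positivity) two_ne_zero).1 ?_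
    rw [mul_pow, mul_pow, h0, h1, h2, hsq]
    ring
  have : n0⁻¹ * jacDet f x * (n1⁻¹ * jacDet f x) * (n2⁻¹ * jacDet f x)
      = (n0 * n1 * n2)⁻¹ * jacDet f x ^ 2 * jacDet f x := by
    rw [mul_inv, mul_inv]; ring
  rw [this, hprod, inv_mul_cancel₀ (pow_ne_zero 2 hD), one_mul]

theorem contDiffOn_cross {a b : R3 → R3} (ha : ContDiffOn ℝ ∞ a U) (hb : ContDiffOn ℝ ∞ b U) :
    ContDiffOn ℝ ∞ (fun x => cross (a x) (b x)) U := by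
  rw [contDiffOn_euclidean] at ha hb ⊢
  intro i
  have h0 := ha 0
  have h1 := ha 1
  have h2 := ha 2
  have k0 := hb 0
  have k1 := hb 1
  have k2 := hb 2
  fin_cases i <;> simp only [cross, cross_apply] <;> simp <;> fun_prop

theorem IsTriplyOrthogonal.differentiableAt_lame (hU : IsOpen U) (hf : IsTriplyOrthogonal U f)
    (hx : x ∈ U) (i : Fin 3) : DifferentiableAt ℝ (lame f i) x := by
  have hd : ∀ j, DifferentiableAt ℝ (pd j f) x := fun j =>
    differentiableAt_of_contDiffOn hU (contDiffOn_pd hU hf.smooth j) hx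
  have hc : DifferentiableAt ℝ (fun y => cross (pd (i + 1) f y) (pd (i + 2) f y)) x :=
    differentiableAt_of_contDiffOn hU (contDiffOn_cross (contDiffOn_pd hU hf.smooth _)
      (contDiffOn_pd hU hf.smooth _)) hx
  have hn := hc.norm ℝ (hf.cross_ne_zero hx i)
  exact (hd i).inner ℝ ((hn.inv (norm_ne_zero_iff.2 (hf.cross_ne_zero hx i))).smul hc)

theorem IsTriplyOrthogonal.lame_mul_pd_lame (hU : IsOpen U) (hf : IsTriplyOrthogonal U f)
    (hx : x ∈ U) (i j : Fin 3) :
    lame f j x * pd i (lame f j) x = inner ℝ (pd i (pd j f) x) (pd j f x) := by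
  have hd : DifferentiableAt ℝ (pd j f) x :=
    differentiableAt_of_contDiffOn hU (contDiffOn_pd hU hf.smooth j) hx
  have hl := hf.differentiableAt_lame hU hx j
  have h := pd_congr hU (g := fun y => lame f j y * lame f j y)
    (k := fun y => inner ℝ (pd j f y) (pd j f y))
    (fun y hy => by rw [← hf.lame_sq hy]; ring) hx i
  rw [pd_mul_fun hl hl, pd_inner hd hd, real_inner_comm] at h
  linarith

end Lame

theorem eps_zero : eps 0 = 1 := rfl

theorem eps_one : eps 1 = 1 := rfl

theorem eps_two : eps 2 = -1 := rfl

/-! ### Combescure transforms and the Lorentzian trace form. -/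

section Combescure

theorem IsCombescureWith.coeff_eq (hf : IsTriplyOrthogonal U f) (hg : IsCombescureWith U f g p)
    (hx : x ∈ U) (i : Fin 3) :
    p i x = inner ℝ (pd i g x) (pd i f x) / inner ℝ (pd i f x) (pd i f x) := by
  rw [hg.pd_eq x hx i, inner_smul_left, conj_trivial,
    mul_div_cancel_right₀ _ (hf.inner_pos hx i).ne']

/-- No regularity of the coefficients is assumed; it comes from their expression as quotients of
smooth inner products. -/
theorem IsCombescureWith.differentiableAt (hU : IsOpen U) (hf : IsTriplyOrthogonal U f)
    (hg : IsCombescureWith U f g p) (hx : x ∈ U) (i : Fin 3) : DifferentiableAt ℝ (p i) x := by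
  have hfd : DifferentiableAt ℝ (pd i f) x :=
    differentiableAt_of_contDiffOn hU (contDiffOn_pd hU hf.smooth i) hx
  have hgd : DifferentiableAt ℝ (pd i g) x :=
    differentiableAt_of_contDiffOn hU (contDiffOn_pd hU hg.smooth i) hx
  have := (hgd.inner ℝ hfd).mul ((hfd.inner ℝ hfd).inv (hf.inner_pos hx i).ne')
  exact this.congr_of_eventuallyEq
    (Filter.eventuallyEq_of_mem (hU.mem_nhds hx) fun y hy => (hg.coeff_eq hf hy i).trans (div_eq_mul_inv _ _))

theorem IsCombescureWith.pd_pd (hU : IsOpen U) (hf : IsTriplyOrthogonal U f)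
    (hg : IsCombescureWith U f g p) (hx : x ∈ U) (i j : Fin 3) :
    pd i (pd j g) x = p j x • pd i (pd j f) x + pd i (p j) x • pd j f x := by
  rw [pd_congr hU (fun y hy => hg.pd_eq y hy j) hx i,
    pd_smul_fun (hg.differentiableAt hU hf hx j)
      (differentiableAt_of_contDiffOn hU (contDiffOn_pd hU hf.smooth j) hx)]

/-- The integrability condition `∂_i ∂_j g = ∂_j ∂_i g`, paired with `∂_j f`; orthogonality removes
the derivative of `p i`. -/
theorem IsCombescureWith.pd_coeff (hU : IsOpen U) (hf : IsTriplyOrthogonal U f)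
    (hg : IsCombescureWith U f g p) (hx : x ∈ U) {i j : Fin 3} (hij : i ≠ j) :
    pd i (p j) x * inner ℝ (pd j f x) (pd j f x)
      = (p i x - p j x) * inner ℝ (pd i (pd j f) x) (pd j f x) := by
  have h := pd_comm hU hg.smooth hx i j
  rw [hg.pd_pd hU hf hx, hg.pd_pd hU hf hx, pd_comm hU hf.smooth hx j i] at h
  have h2 := congrArg (fun v => inner ℝ v (pd j f x)) h
  simp only [inner_add_left, inner_smul_left, conj_trivial, hf.orthogonal x hx i j hij] at h2
  linarith

/-- The form `(∂_0 g, ∂_0 k) + (∂_1 g, ∂_1 k) - (∂_2 g, ∂_2 k)`. -/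
noncomputable def traceForm (g k : R3 → R3) (x : R3) : ℝ :=
  inner ℝ (pd 0 g x) (pd 0 k x) + inner ℝ (pd 1 g x) (pd 1 k x) - inner ℝ (pd 2 g x) (pd 2 k x)

/-- The derivative of `traceForm g f` in direction `i`, for the Combescure transform `g` of a
Guichard net `f` with coefficients `p`, vanishes exactly if this expression does. -/
noncomputable def traceDefect (f : R3 → R3) (p : Fin 3 → R3 → ℝ) (i : Fin 3) (x : R3) : ℝ :=
  eps i * pd i (p i) x * inner ℝ (pd i f x) (pd i f x)
    + (p 0 x * inner ℝ (pd i (pd 0 f) x) (pd 0 f x) + p 1 x * inner ℝ (pd i (pd 1 f) x) (pd 1 f x)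
      - p 2 x * inner ℝ (pd i (pd 2 f) x) (pd 2 f x))

theorem contDiffOn_traceForm (hU : IsOpen U) (hg : ContDiffOn ℝ ∞ g U)
    (hk : ContDiffOn ℝ ∞ k U) : ContDiffOn ℝ ∞ (traceForm g k) U := by
  have h : ∀ i, ContDiffOn ℝ ∞ (fun x => inner ℝ (pd i g x) (pd i k x)) U := fun i =>
    (contDiffOn_pd hU hg i).inner ℝ (contDiffOn_pd hU hk i)
  exact ((h 0).add (h 1)).sub (h 2)

/-- In the summands with `j ≠ i`, `pd_coeff` eliminates the derivatives of the coefficients, and the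
terms in `p j * q j` cancel; the rest is linear in `p i` and `q i`. -/
theorem pd_traceForm (hU : IsOpen U) (hf : IsTriplyOrthogonal U f)
    (hg : IsCombescureWith U f g p) (hk : IsCombescureWith U f k q) (hx : x ∈ U) (i : Fin 3) :
    pd i (traceForm g k) x = p i x * traceDefect f q i x + q i x * traceDefect f p i x := by
  have hgd : ∀ j, DifferentiableAt ℝ (pd j g) x := fun j =>
    differentiableAt_of_contDiffOn hU (contDiffOn_pd hU hg.smooth j) hx
  have hkd : ∀ j, DifferentiableAt ℝ (pd j k) x := fun j =>
    differentiableAt_of_contDiffOn hU (contDiffOn_pd hU hk.smooth j) hx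
  have hin : ∀ j, DifferentiableAt ℝ (fun y => inner ℝ (pd j g y) (pd j k y)) x :=
    fun j => (hgd j).inner ℝ (hkd j)
  have hterm : ∀ j, pd i (fun y => inner ℝ (pd j g y) (pd j k y)) x
      = 2 * p j x * q j x * inner ℝ (pd i (pd j f) x) (pd j f x)
        + (p j x * pd i (q j) x + q j x * pd i (p j) x) * inner ℝ (pd j f x) (pd j f x) := by
    intro j
    rw [pd_inner (hgd j) (hkd j), hg.pd_pd hU hf hx, hk.pd_pd hU hf hx, hg.pd_eq x hx,
      hk.pd_eq x hx]
    simp only [inner_add_left, inner_add_right, inner_smul_left, inner_smul_right, conj_trivial,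
      real_inner_comm (pd j f x) (pd i (pd j f) x)]
    ring
  have hp : ∀ j, i ≠ j → _ := fun j hij => hg.pd_coeff hU hf hx hij
  have hq : ∀ j, i ≠ j → _ := fun j hij => hk.pd_coeff hU hf hx hij
  have hsum : pd i (traceForm g k) x = pd i (fun y => inner ℝ (pd 0 g y) (pd 0 k y)) x
      + pd i (fun y => inner ℝ (pd 1 g y) (pd 1 k y)) x
      - pd i (fun y => inner ℝ (pd 2 g y) (pd 2 k y)) x := by
    rw [← pd_add_fun (hin 0) (hin 1), ← pd_sub_fun ((hin 0).fun_add (hin 1)) (hin 2)]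
    rfl
  rw [hsum, hterm, hterm, hterm]
  unfold traceDefect
  obtain rfl | rfl | rfl : i = 0 ∨ i = 1 ∨ i = 2 := by fin_cases i <;> simp
  all_goals simp only [eps_zero, eps_one, eps_two]
  · linear_combination p 1 x * hq 1 (by decide) + q 1 x * hp 1 (by decide)
      - p 2 x * hq 2 (by decide) - q 2 x * hp 2 (by decide)
  · linear_combination p 0 x * hq 0 (by decide) + q 0 x * hp 0 (by decide)
      - p 2 x * hq 2 (by decide) - q 2 x * hp 2 (by decide)
  · linear_combination p 0 x * hq 0 (by decide) + q 0 x * hp 0 (by decide)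
      + p 1 x * hq 1 (by decide) + q 1 x * hp 1 (by decide)

end Combescure

/-! ### Invariance of the algebraic relations under a Lorentz reflection. -/

section Algebra

/-- The components of the reflection in `q` of two vectors `p`, `1` of a Lorentz space whose
cross product is `± 1` have the cross product `∓ 1`. -/
theorem reflected_cross {E0 E1 E2 D N p0 p1 p2 q0 q1 q2 cf cg : ℝ} (h0 : E0 ≠ 0) (h1 : E1 ≠ 0)
    (h2 : E2 ≠ 0) (hN0 : N ≠ 0) (hE : E0 + E1 = E2)
    (hN : N = q0 ^ 2 * E0 + q1 ^ 2 * E1 - q2 ^ 2 * E2)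
    (hcf : N * cf = 2 * (q0 * E0 + q1 * E1 - q2 * E2))
    (hcg : N * cg = 2 * (p0 * q0 * E0 + p1 * q1 * E1 - p2 * q2 * E2))
    (hp0 : p0 = p2 + D / (E0 * E2)) (hp1 : p1 = p2 - D / (E1 * E2)) :
    ((p0 - cg * q0) * (1 - cf * q2) - (p2 - cg * q2) * (1 - cf * q0)) * (E0 * E2)
        = -((1 - cf * q1) * D) ∧
      ((p1 - cg * q1) * (1 - cf * q2) - (p2 - cg * q2) * (1 - cf * q1)) * (E1 * E2)
        = (1 - cf * q0) * D := by
  obtain ⟨e, rfl⟩ : ∃ e, D = e * E2 := ⟨D / E2, by field_simp⟩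
  have ha : (p0 - p2) * E0 = e := by rw [hp0]; field_simp; ring
  have hb : (p1 - p2) * E1 = -e := by rw [hp1]; field_simp; ring
  have hcg' : N * cg = N * p2 * cf + 2 * e * (q0 - q1) := by
    -- Only the difference between `p` and the constant vector `p2` contributes beyond `p2 * cf`.
    linear_combination hcg - p2 * hcf + 2 * q0 * ha + 2 * q1 * hb
  -- With the weights `s = (E0, E1, -E2)`, whose sum is zero, the left side is `2 ∑ s_j (q_j - q1)
  -- (q_j - q2)`, where only `j = 0` survives. The next identity is the same with `q0`, `q2`.
  have key0 : 2 * N - N * cf * (q1 + q2) = 2 * E0 * (q0 - q1) * (q0 - q2) := by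
    linear_combination 2 * hN - (q1 + q2) * hcf - 2 * q1 * q2 * hE
  have key1 : 2 * N - N * cf * (q0 + q2) = 2 * E1 * (q1 - q0) * (q1 - q2) := by
    linear_combination 2 * hN - (q0 + q2) * hcf - 2 * q0 * q2 * hE
  constructor <;> apply mul_left_cancel₀ hN0
  · linear_combination (-E0 * E2 * (q0 - q2)) * hcg' + E2 * e * key0
      + N * E2 * (1 - cf * q2) * ha
  · linear_combination (-E1 * E2 * (q1 - q2)) * hcg' - E2 * e * key1
      + N * E2 * (1 - cf * q2) * hb

/-- The relation `d i + p i ^ 2 = u i`, for vectors satisfying the completeness relation of a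
Lorentz space with the metric `s = u⁻¹`, is invariant under reflection in `q`. -/
theorem reflected_completeness {s u p q d : Fin 3 → ℝ} {N cf cg cd : ℝ} (hN0 : N ≠ 0)
    (hsu : ∀ i, s i * u i = 1) (hd : ∀ i, d i = -p i ^ 2 + u i)
    (hp : ∀ i j, i ≠ j → (p i - p j) ^ 2 = u i + u j)
    (hN : N = ∑ j, s j * q j ^ 2) (hcf : N * cf = 2 * ∑ j, s j * q j)
    (hcg : N * cg = 2 * ∑ j, s j * (p j * q j)) (hcd : N * cd = 2 * ∑ j, s j * (d j * q j))
    (i : Fin 3) :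
    (d i - cd * q i) * (1 - cf * q i) + (p i - cg * q i) ^ 2 = u i := by
  -- The completeness relation applied to `q`: its off-diagonal entries `d i + d j + 2 * p i * p j`
  -- vanish by `hp`.
  have K : ∀ i, N * (cd + cf * d i + 2 * cg * p i) = 4 * q i := by
    intro i
    have h1 : N * (cd + cf * d i + 2 * cg * p i)
        = ∑ j, 2 * (s j * q j) * (u i + u j - (p i - p j) ^ 2) := by
      have : N * (cd + cf * d i + 2 * cg * p i)
          = N * cd + N * cf * d i + 2 * (N * cg) * p i := by ring
      rw [this, hcd, hcf, hcg]
      simp only [Fin.sum_univ_three, hd]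
      ring
    rw [h1, Finset.sum_eq_single i]
    · linear_combination 4 * q i * hsu i
    · intro j _ hj
      rw [hp i j (Ne.symm hj)]; ring
    · simp
  -- Pairing `K` once more with `q`.
  have key : N * (cd * cf + cg ^ 2) = 4 := by
    apply mul_left_cancel₀ hN0
    simp only [Fin.sum_univ_three] at hN hcf hcg hcd
    linear_combination s 0 * q 0 * K 0 + s 1 * q 1 * K 1 + s 2 * q 2 * K 2 - 4 * hN
      + N * (cd * hcf + cf * hcd + 2 * cg * hcg) / 2
  apply mul_left_cancel₀ hN0
  linear_combination N * hd i - q i * K i + q i ^ 2 * key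

end Algebra

/-! ### Guichard nets and the equations of associated systems. -/

section Guichard

theorem IsGuichardNet.inner_add (hf : IsGuichardNet U f) (hx : x ∈ U) :
    inner ℝ (pd 0 f x) (pd 0 f x) + inner ℝ (pd 1 f x) (pd 1 f x)
      = inner ℝ (pd 2 f x) (pd 2 f x) := by
  have ht := hf.triplyOrthogonal
  rw [← ht.lame_sq hx, ← ht.lame_sq hx, ← ht.lame_sq hx]
  linarith [hf.trace_eq x hx]

theorem isCombescureWith_self (hf : IsTriplyOrthogonal U f) :
    IsCombescureWith U f f fun _ _ => 1 :=
  ⟨hf.smooth, fun _ _ _ => (one_smul _ _).symm⟩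

theorem IsCombescureWith.traceForm_eq (hg : IsCombescureWith U f g p)
    (hk : IsCombescureWith U f k q) (hx : x ∈ U) :
    traceForm g k x = p 0 x * q 0 x * inner ℝ (pd 0 f x) (pd 0 f x)
      + p 1 x * q 1 x * inner ℝ (pd 1 f x) (pd 1 f x)
      - p 2 x * q 2 x * inner ℝ (pd 2 f x) (pd 2 f x) := by
  simp only [traceForm, hg.pd_eq x hx, hk.pd_eq x hx, inner_smul_left, inner_smul_right,
    conj_trivial]
  ring

theorem IsGuichardNet.traceDefect_one (hU : IsOpen U) (hf : IsGuichardNet U f) (hx : x ∈ U)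
    (i : Fin 3) : traceDefect f (fun _ _ => 1) i x = 0 := by
  have ht := hf.triplyOrthogonal
  have hs := isCombescureWith_self ht
  have h := pd_traceForm hU ht hs hs hx i
  rw [pd_congr hU (k := fun _ => (0 : ℝ)) (fun y hy => by
    rw [traceForm, hf.inner_add hy, sub_self]) hx, pd_const] at h
  linarith

theorem IsGuichardNet.traceDefect_eq_zero (hU : IsOpen U) (hf : IsGuichardNet U f)
    (hg : IsCombescureWith U f g p) {c : ℝ} (hc : ∀ y ∈ U, traceForm g f y = c) (hx : x ∈ U)
    (i : Fin 3) : traceDefect f p i x = 0 := by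
  have ht := hf.triplyOrthogonal
  have h := pd_traceForm hU ht hg (isCombescureWith_self ht) hx i
  rw [pd_congr hU hc hx, pd_const, hf.traceDefect_one hU hx] at h
  linarith

theorem IsTriplyOrthogonal.lame_div_one (hf : IsTriplyOrthogonal U f) (hx : x ∈ U) :
    lame f 1 x / (lame f 0 x * lame f 2 x)
      = jacDet f x / (inner ℝ (pd 0 f x) (pd 0 f x) * inner ℝ (pd 2 f x) (pd 2 f x)) := by
  rw [← hf.lame_prod hx, ← hf.lame_sq hx, ← hf.lame_sq hx]
  have h0 := hf.lame_ne_zero hx 0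
  have h2 := hf.lame_ne_zero hx 2
  field_simp

theorem IsTriplyOrthogonal.lame_div_zero (hf : IsTriplyOrthogonal U f) (hx : x ∈ U) :
    lame f 0 x / (lame f 1 x * lame f 2 x)
      = jacDet f x / (inner ℝ (pd 1 f x) (pd 1 f x) * inner ℝ (pd 2 f x) (pd 2 f x)) := by
  rw [← hf.lame_prod hx, ← hf.lame_sq hx, ← hf.lame_sq hx]
  have h1 := hf.lame_ne_zero hx 1
  have h2 := hf.lame_ne_zero hx 2
  field_simp

/-- The differential equations for `h_3` are consequences of the two algebraic ones. In the
directions 0 and 1 they are the integrability condition `pd_coeff`. -/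
theorem IsGuichardNet.isAssociatedData (hU : IsOpen U) (hf : IsGuichardNet U f)
    (hg : IsCombescureWith U f g p)
    (h_one : ∀ x ∈ U, p 0 x = p 2 x + lame f 1 x / (lame f 0 x * lame f 2 x))
    (h_two : ∀ x ∈ U, p 1 x = p 2 x - lame f 0 x / (lame f 1 x * lame f 2 x)) :
    IsAssociatedData U f p := by
  have ht := hf.triplyOrthogonal
  have hpd : ∀ x ∈ U, ∀ i j : Fin 3, i ≠ j →
      pd i (p j) x * lame f j x = (p i x - p j x) * pd i (lame f j) x := by
    intro x hx i j hij
    have h := hg.pd_coeff hU ht hx hij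
    rw [← ht.lame_sq hx, ← ht.lame_mul_pd_lame hU hx] at h
    apply mul_left_cancel₀ (ht.lame_ne_zero hx j)
    linear_combination h
  refine ⟨fun x hx => ?_, fun x hx => ?_, fun x hx => ?_, h_one, h_two⟩
  · have h0 := ht.lame_ne_zero hx 0
    have h2 := ht.lame_ne_zero hx 2
    have h := hpd x hx 0 2 (by decide)
    rw [h_one x hx] at h
    rw [eq_div_of_mul_eq h2 h, princCurv, rotCoeff]
    field_simp
    ring
  · have h1 := ht.lame_ne_zero hx 1
    have h2 := ht.lame_ne_zero hx 2
    have h := hpd x hx 1 2 (by decide)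
    rw [h_two x hx] at h
    rw [eq_div_of_mul_eq h2 h, princCurv, rotCoeff]
    field_simp
    ring
  · have h0 := ht.lame_ne_zero hx 0
    have h1 := ht.lame_ne_zero hx 1
    have h2 := ht.lame_ne_zero hx 2
    have hl := fun j => ht.differentiableAt_lame hU hx j
    have hpp := fun j => hg.differentiableAt hU ht hx j
    -- Integrability says nothing about `∂_2 (p 2)`. It is found by differentiating this relation,
    -- with `∂_2 (p 0)` known from integrability, and using the derivative `hq` of the Guichard
    -- condition.
    have hA : (p 0 x - p 2 x) * (lame f 0 x * lame f 2 x) = lame f 1 x := by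
      rw [h_one x hx]; field_simp; ring
    have hdA := pd_congr hU (g := fun y => (p 0 y - p 2 y) * (lame f 0 y * lame f 2 y))
      (k := lame f 1) (fun y hy => by
        have h0 := ht.lame_ne_zero hy 0
        have h2 := ht.lame_ne_zero hy 2
        rw [h_one y hy]; field_simp; ring) hx 2
    rw [pd_mul_fun ((hpp 0).fun_sub (hpp 2)) ((hl 0).fun_mul (hl 2)), pd_mul_fun (hl 0) (hl 2),
      pd_sub_fun (hpp 0) (hpp 2)] at hdA
    have hq := hf.traceDefect_one hU hx 2
    simp only [traceDefect, pd_const, mul_zero, zero_mul, zero_add, one_mul,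
      ← ht.lame_mul_pd_lame hU hx] at hq
    have h20 := hpd x hx 2 0 (by decide)
    have htr := hf.trace_eq x hx
    rw [princCurv, princCurv, rotCoeff, rotCoeff]
    generalize pd 2 (p 0) x = P0 at *
    generalize pd 2 (p 2) x = P2 at *
    generalize pd 2 (lame f 0) x = L0 at *
    generalize pd 2 (lame f 1) x = L1 at *
    generalize pd 2 (lame f 2) x = L2 at *
    generalize lame f 0 x = H0 at *
    generalize lame f 1 x = H1 at *
    generalize lame f 2 x = H2 at *
    have hr : -(H0 * H1 / H2 ^ 2) * (-(L0 / H2) / H0 - -(L1 / H2) / H1)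
        = (H1 * L0 - H0 * L1) / H2 ^ 3 := by
      field_simp
      ring
    rw [hr, eq_div_iff (pow_ne_zero 3 h2)]
    apply mul_left_cancel₀ h0
    have e1 : P2 * H0 * H2 = -L1 + (p 0 x - p 2 x) * H0 * L2 := by
      linear_combination -hdA + H2 * h20
    have e2 : P2 * H0 * H2 ^ 2 = -L1 * H2 + H1 * L2 := by
      linear_combination H2 * e1 + L2 * hA
    have e3 : H2 * L2 = H0 * L0 + H1 * L1 := by linear_combination -hq
    linear_combination H2 * e2 + H1 * e3 + L1 * htr

end Guichard

/-- An `α² |fbar|²`-system `fbar` that is a Combescure transform, with coefficients `q`, of the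
Guichard net `f`, and whose Bäcklund-type transform is nondegenerate. -/
structure BacklundPair (U : Set R3) (α : ℝ) (f fbar : R3 → R3) (q : Fin 3 → R3 → ℝ) : Prop where
  isOpen : IsOpen U
  guichard : IsGuichardNet U f
  chiSystem : IsChiSystem U (fun x => α ^ 2 * ‖fbar x‖ ^ 2) fbar
  combescure : IsCombescureWith U f fbar q
  alpha_ne_zero : α ≠ 0
  ne_zero : ∀ x ∈ U, fbar x ≠ 0
  jacDet_ne_zero : ∀ x ∈ U, jacDet (backlund α fbar f) x ≠ 0

/-- The coefficient of `fbar` in the Bäcklund-type transform `g - s fbar` of `g`. -/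
noncomputable def backlundScale (α : ℝ) (fbar g : R3 → R3) (x : R3) : ℝ :=
  2 * backlundPhi α fbar g x / ‖fbar x‖ ^ 2

/-! ### The Bäcklund-type transform as a pair of reflections. -/

namespace BacklundPair

theorem tos (hB : BacklundPair U α f fbar q) : IsTriplyOrthogonal U f :=
  hB.guichard.triplyOrthogonal

theorem norm_sq_ne_zero (hB : BacklundPair U α f fbar q) (hx : x ∈ U) : ‖fbar x‖ ^ 2 ≠ 0 :=
  pow_ne_zero 2 (norm_ne_zero_iff.2 (hB.ne_zero x hx))

theorem coeff_ne_zero (hB : BacklundPair U α f fbar q) (hx : x ∈ U) (i : Fin 3) : q i x ≠ 0 := by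
  intro h
  apply hB.chiSystem.triplyOrthogonal.pd_ne_zero hx i
  rw [hB.combescure.pd_eq x hx i, h, zero_smul]

/-- The unit normals enter `φ` only in pairs, so their signs drop out. As `q` has no zeros, `g` is
also a Combescure transform of `fbar`. -/
theorem backlundPhi_eq (hB : BacklundPair U α f fbar q) (hg : IsCombescureWith U f g p)
    (hx : x ∈ U) : backlundPhi α fbar g x = 1 / α ^ 2 * traceForm g fbar x := by
  have h : ∀ i, lameWrt fbar g i x * lame fbar i x = inner ℝ (pd i g x) (pd i fbar x) := by
    intro i
    have hpd : pd i g x = (p i x / q i x) • pd i fbar x := by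
      rw [hB.combescure.pd_eq x hx, smul_smul, div_mul_cancel₀ _ (hB.coeff_ne_zero hx i),
        hg.pd_eq x hx]
    rw [lameWrt_eq hpd, mul_assoc, ← sq, hB.chiSystem.triplyOrthogonal.lame_sq hx]
    conv_rhs => rw [hpd, inner_smul_left, conj_trivial]
  rw [backlundPhi, h, h, h, traceForm]

theorem scale_mul (hB : BacklundPair U α f fbar q) (hg : IsCombescureWith U f g p)
    (hx : x ∈ U) :
    α ^ 2 * ‖fbar x‖ ^ 2 * backlundScale α fbar g x = 2 * traceForm g fbar x := by
  rw [backlundScale, hB.backlundPhi_eq hg hx]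
  have h1 := hB.norm_sq_ne_zero hx
  have h2 := hB.alpha_ne_zero
  generalize ‖fbar x‖ ^ 2 = n at *
  field_simp

theorem traceForm_self (hB : BacklundPair U α f fbar q) (hx : x ∈ U) :
    traceForm fbar fbar x = α ^ 2 * ‖fbar x‖ ^ 2 := by
  have ht := hB.chiSystem.triplyOrthogonal
  rw [← hB.chiSystem.trace_eq x hx, ht.lame_sq hx, ht.lame_sq hx, ht.lame_sq hx, traceForm]

theorem pd_norm_sq (hB : BacklundPair U α f fbar q) (hx : x ∈ U) (i : Fin 3) :
    pd i (fun y => ‖fbar y‖ ^ 2) x = 2 * (q i x * inner ℝ (pd i f x) (fbar x)) := by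
  have hd := differentiableAt_of_contDiffOn hB.isOpen hB.combescure.smooth hx
  simp only [← real_inner_self_eq_norm_sq]
  rw [pd_inner hd hd, hB.combescure.pd_eq x hx, inner_smul_left, inner_smul_right, conj_trivial,
    real_inner_comm (pd i f x)]
  ring

theorem differentiableAt_norm_sq (hB : BacklundPair U α f fbar q) (hx : x ∈ U) :
    DifferentiableAt ℝ (fun y => ‖fbar y‖ ^ 2) x :=
  (differentiableAt_of_contDiffOn hB.isOpen hB.combescure.smooth hx).norm_sq ℝ

/-- Differentiating `traceForm fbar fbar = α² |fbar|²` produces a common factor `2 * q i`, which is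
nonzero. -/
theorem traceDefect_eq (hB : BacklundPair U α f fbar q) (hx : x ∈ U) (i : Fin 3) :
    traceDefect f q i x = α ^ 2 * inner ℝ (pd i f x) (fbar x) := by
  have h := pd_traceForm hB.isOpen hB.tos hB.combescure hB.combescure hx i
  rw [pd_congr hB.isOpen (fun y hy => hB.traceForm_self hy) hx,
    pd_const_mul (hB.differentiableAt_norm_sq hx), hB.pd_norm_sq hx] at h
  apply mul_left_cancel₀ (hB.coeff_ne_zero hx i)
  linarith

theorem contDiffOn_scale (hB : BacklundPair U α f fbar q) (hg : IsCombescureWith U f g p) :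
    ContDiffOn ℝ ∞ (backlundScale α fbar g) U := by
  have h1 := contDiffOn_traceForm hB.isOpen hg.smooth hB.combescure.smooth
  have h : ContDiffOn ℝ ∞ (fun y => 2 * (1 / α ^ 2 * traceForm g fbar y) / ‖fbar y‖ ^ 2) U :=
    (contDiffOn_const.mul (contDiffOn_const.mul h1)).div (hB.combescure.smooth.norm_sq ℝ)
      fun y hy => hB.norm_sq_ne_zero hy
  exact h.congr fun y hy => by rw [backlundScale, hB.backlundPhi_eq hg hy]

theorem contDiffOn_backlund (hB : BacklundPair U α f fbar q) (hg : IsCombescureWith U f g p) :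
    ContDiffOn ℝ ∞ (backlund α fbar g) U :=
  hg.smooth.sub ((hB.contDiffOn_scale hg).smul hB.combescure.smooth)

/-- The central computation: the derivative of the scale carries the same factor `p i - s * q i` as
the tangential part, so that both combine into one reflected vector. -/
theorem pd_backlund (hB : BacklundPair U α f fbar q) (hg : IsCombescureWith U f g p) {c : ℝ}
    (hc : ∀ y ∈ U, traceForm g f y = c) (hx : x ∈ U) (i : Fin 3) :
    pd i (backlund α fbar g) x
      = (p i x - backlundScale α fbar g x * q i x) • reflect (fbar x) (pd i f x) := by
  have hU := hB.isOpen
  have hn := hB.norm_sq_ne_zero hx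
  have hfd := differentiableAt_of_contDiffOn hU hB.combescure.smooth hx
  have hgd := differentiableAt_of_contDiffOn hU hg.smooth hx
  have hsd := differentiableAt_of_contDiffOn hU (hB.contDiffOn_scale hg) hx
  have hTd := differentiableAt_of_contDiffOn hU
    (contDiffOn_traceForm hU hg.smooth hB.combescure.smooth) hx
  have hscale : pd i (backlundScale α fbar g) x = (p i x - backlundScale α fbar g x * q i x)
      * (2 * inner ℝ (pd i f x) (fbar x) / ‖fbar x‖ ^ 2) := by
    -- Differentiating the defining relation of the scale; constancy of `traceForm g f` leaves only
    -- the defect of `fbar` on the right.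
    have h := pd_congr hU (g := fun y => α ^ 2 * ‖fbar y‖ ^ 2 * backlundScale α fbar g y)
      (k := fun y => 2 * traceForm g fbar y) (fun y hy => hB.scale_mul hg hy) hx i
    have hnd := hB.differentiableAt_norm_sq hx
    rw [pd_mul_fun (hnd.const_mul _) hsd, pd_const_mul hnd, hB.pd_norm_sq hx, pd_const_mul hTd,
      pd_traceForm hU hB.tos hg hB.combescure hx, hB.traceDefect_eq hx,
      hB.guichard.traceDefect_eq_zero hU hg hc hx] at h
    have hα := pow_ne_zero 2 hB.alpha_ne_zero
    generalize ‖fbar x‖ ^ 2 = n at *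
    field_simp
    apply mul_left_cancel₀ hα
    linear_combination h
  have hb : backlund α fbar g = fun y => g y - backlundScale α fbar g y • fbar y := rfl
  rw [hb, pd_sub_fun hgd (hsd.fun_smul hfd), pd_smul_fun hsd hfd, hscale, hg.pd_eq x hx,
    hB.combescure.pd_eq x hx, reflect]
  module

theorem traceForm_f (hB : BacklundPair U α f fbar q) : ∀ y ∈ U, traceForm f f y = 0 :=
  fun y hy => by rw [traceForm, hB.guichard.inner_add hy, sub_self]

theorem pd_backlund_base (hB : BacklundPair U α f fbar q) (hx : x ∈ U) (i : Fin 3) :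
    pd i (backlund α fbar f) x
      = (1 - backlundScale α fbar f x * q i x) • reflect (fbar x) (pd i f x) :=
  hB.pd_backlund (isCombescureWith_self hB.tos) hB.traceForm_f hx i

theorem inner_pd_backlund (hB : BacklundPair U α f fbar q) (hx : x ∈ U) (i j : Fin 3) :
    inner ℝ (pd i (backlund α fbar f) x) (pd j (backlund α fbar f) x)
      = (1 - backlundScale α fbar f x * q i x) * (1 - backlundScale α fbar f x * q j x)
        * inner ℝ (pd i f x) (pd j f x) := by
  rw [hB.pd_backlund_base hx, hB.pd_backlund_base hx, inner_smul_left, inner_smul_right,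
    inner_reflect (hB.ne_zero x hx), conj_trivial]
  ring

theorem jacDet_backlund (hB : BacklundPair U α f fbar q) (hx : x ∈ U) :
    jacDet (backlund α fbar f) x
      = -((1 - backlundScale α fbar f x * q 0 x) * (1 - backlundScale α fbar f x * q 1 x)
        * (1 - backlundScale α fbar f x * q 2 x) * jacDet f x) := by
  rw [jacDet_eq, jacDet_eq, hB.pd_backlund_base hx, hB.pd_backlund_base hx,
    hB.pd_backlund_base hx, tripleDet_smul, tripleDet_reflect (hB.ne_zero x hx)]
  ring

theorem factor_ne_zero (hB : BacklundPair U α f fbar q) (hx : x ∈ U) (i : Fin 3) :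
    1 - backlundScale α fbar f x * q i x ≠ 0 := by
  intro h
  apply hB.jacDet_ne_zero x hx
  rw [hB.jacDet_backlund hx]
  fin_cases i <;> simp only [Fin.zero_eta, Fin.mk_one, Fin.reduceFinMk] at h <;> rw [h] <;> ring

theorem isTriplyOrthogonal (hB : BacklundPair U α f fbar q) :
    IsTriplyOrthogonal U (backlund α fbar f) where
  smooth := hB.contDiffOn_backlund (isCombescureWith_self hB.tos)
  jacDet_ne_zero := hB.jacDet_ne_zero
  orthogonal x hx i j hij := by
    rw [hB.inner_pd_backlund hx, hB.tos.orthogonal x hx i j hij, mul_zero]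

theorem isGuichardNet (hB : BacklundPair U α f fbar q) :
    IsGuichardNet U (backlund α fbar f) where
  triplyOrthogonal := hB.isTriplyOrthogonal
  trace_eq x hx := by
    have ht := hB.isTriplyOrthogonal
    rw [ht.lame_sq hx, ht.lame_sq hx, ht.lame_sq hx, hB.inner_pd_backlund hx,
      hB.inner_pd_backlund hx, hB.inner_pd_backlund hx]
    have h1 := hB.guichard.inner_add hx
    have h2 := hB.scale_mul (isCombescureWith_self hB.tos) hx
    have h3 := hB.traceForm_self hx
    rw [(isCombescureWith_self hB.tos).traceForm_eq hB.combescure hx] at h2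
    rw [hB.combescure.traceForm_eq hB.combescure hx] at h3
    linear_combination h1 + backlundScale α fbar f x ^ 2 * h3
      + backlundScale α fbar f x * h2

theorem isCombescureWith_backlund (hB : BacklundPair U α f fbar q)
    (hg : IsCombescureWith U f g p) {c : ℝ} (hc : ∀ y ∈ U, traceForm g f y = c) :
    IsCombescureWith U (backlund α fbar f) (backlund α fbar g) fun i x =>
      (p i x - backlundScale α fbar g x * q i x) / (1 - backlundScale α fbar f x * q i x) where
  smooth := hB.contDiffOn_backlund hg
  pd_eq x hx i := by
    rw [hB.pd_backlund hg hc hx, hB.pd_backlund_base hx, smul_smul,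
      div_mul_cancel₀ _ (hB.factor_ne_zero hx i)]

end BacklundPair

/-! ### Lorentzian relations between a net and its associated systems. -/

theorem IsAssociatedData.sub_eq (hf : IsGuichardNet U f) (hp : IsAssociatedData U f p)
    (hx : x ∈ U) :
    p 0 x = p 2 x
        + jacDet f x / (inner ℝ (pd 0 f x) (pd 0 f x) * inner ℝ (pd 2 f x) (pd 2 f x)) ∧
      p 1 x = p 2 x
        - jacDet f x / (inner ℝ (pd 1 f x) (pd 1 f x) * inner ℝ (pd 2 f x) (pd 2 f x)) := by
  rw [← hf.triplyOrthogonal.lame_div_one hx, ← hf.triplyOrthogonal.lame_div_zero hx]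
  exact ⟨hp.h_one x hx, hp.h_two x hx⟩

theorem IsAssociatedData.traceForm_eq_zero (hf : IsGuichardNet U f)
    (hg : IsCombescureWith U f g p) (hp : IsAssociatedData U f p) (hx : x ∈ U) :
    traceForm g f x = 0 := by
  have ht := hf.triplyOrthogonal
  obtain ⟨h0, h1⟩ := hp.sub_eq hf hx
  rw [hg.traceForm_eq (isCombescureWith_self ht) hx, h0, h1, ← hf.inner_add hx]
  have e0 := (ht.inner_pos hx 0).ne'
  have e1 := (ht.inner_pos hx 1).ne'
  have e2 := (ht.inner_pos hx 2).ne'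
  rw [← hf.inner_add hx] at e2
  field_simp
  ring

/-- The off-diagonal part of the completeness relation, with the dual coefficients `-p i ^ 2 + eps i
/ H_i ^ 2` substituted. -/
theorem IsAssociatedData.sub_sq (hf : IsGuichardNet U f) (hp : IsAssociatedData U f p)
    (hx : x ∈ U) {i j : Fin 3} (hij : i ≠ j) :
    (p i x - p j x) ^ 2 = eps i / lame f i x ^ 2 + eps j / lame f j x ^ 2 := by
  have ht := hf.triplyOrthogonal
  have h0 := hp.h_one x hx
  have h1 := hp.h_two x hx
  have htr := hf.trace_eq x hx
  have l0 := ht.lame_ne_zero hx 0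
  have l1 := ht.lame_ne_zero hx 1
  have l2 := ht.lame_ne_zero hx 2
  have k02 : (p 0 x - p 2 x) ^ 2 = 1 / lame f 0 x ^ 2 + -1 / lame f 2 x ^ 2 := by
    rw [h0, add_sub_cancel_left]; field_simp; linear_combination htr
  have k12 : (p 1 x - p 2 x) ^ 2 = 1 / lame f 1 x ^ 2 + -1 / lame f 2 x ^ 2 := by
    rw [h1, sub_sub_cancel_left]; field_simp; linear_combination htr
  have k01 : (p 0 x - p 1 x) ^ 2 = 1 / lame f 0 x ^ 2 + 1 / lame f 1 x ^ 2 := by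
    rw [h0, h1]; field_simp
    linear_combination (lame f 0 x ^ 2 + lame f 1 x ^ 2) * htr
  fin_cases i <;> fin_cases j <;>
    simp only [Fin.zero_eta, Fin.mk_one, Fin.reduceFinMk, eps_zero, eps_one, eps_two] at hij ⊢
  all_goals first
    | exact absurd rfl hij
    | linarith

/-! ### Permutability for associated and dual systems. -/

namespace BacklundPair

theorem isAssociatedData (hB : BacklundPair U α f fbar q) (hg : IsCombescureWith U f g p)
    (hp : IsAssociatedData U f p) :
    IsAssociatedData U (backlund α fbar f) fun i x =>
      (p i x - backlundScale α fbar g x * q i x) / (1 - backlundScale α fbar f x * q i x) := by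
  have hc : ∀ y ∈ U, traceForm g f y = 0 := fun y hy => hp.traceForm_eq_zero hB.guichard hg hy
  have hF := hB.isTriplyOrthogonal
  have key : ∀ x ∈ U, _ := fun x hx =>
    reflected_cross (cf := backlundScale α fbar f x) (cg := backlundScale α fbar g x)
      (q0 := q 0 x) (q1 := q 1 x) (q2 := q 2 x) (N := α ^ 2 * ‖fbar x‖ ^ 2)
      (hB.tos.inner_pos hx 0).ne' (hB.tos.inner_pos hx 1).ne' (hB.tos.inner_pos hx 2).ne'
      (mul_ne_zero (pow_ne_zero 2 hB.alpha_ne_zero) (hB.norm_sq_ne_zero hx))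
      (hB.guichard.inner_add hx)
      (by rw [← hB.traceForm_self hx, hB.combescure.traceForm_eq hB.combescure hx]; ring)
      (by rw [hB.scale_mul (isCombescureWith_self hB.tos) hx,
            (isCombescureWith_self hB.tos).traceForm_eq hB.combescure hx]; ring)
      (by rw [hB.scale_mul hg hx, hg.traceForm_eq hB.combescure hx])
      (hp.sub_eq hB.guichard hx).1 (hp.sub_eq hB.guichard hx).2
  refine hB.isGuichardNet.isAssociatedData hB.isOpen (hB.isCombescureWith_backlund hg hc)
    (fun x hx => ?_) (fun x hx => ?_)
  all_goals
    obtain ⟨h1, h2⟩ := key x hx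
    have e0 := (hB.tos.inner_pos hx 0).ne'
    have e1 := (hB.tos.inner_pos hx 1).ne'
    have e2 := (hB.tos.inner_pos hx 2).ne'
    have r0 := hB.factor_ne_zero hx 0
    have r1 := hB.factor_ne_zero hx 1
    have r2 := hB.factor_ne_zero hx 2
  -- The Euclidean reflection reverses the sign of the Jacobian, which matches the sign that the
  -- Lorentz reflection gives the cross product.
  · rw [hF.lame_div_one hx, hB.jacDet_backlund hx, hB.inner_pd_backlund hx,
      hB.inner_pd_backlund hx]
    generalize 1 - backlundScale α fbar f x * q 0 x = s0 at *
    generalize 1 - backlundScale α fbar f x * q 1 x = s1 at *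
    generalize 1 - backlundScale α fbar f x * q 2 x = s2 at *
    generalize inner ℝ (pd 0 f x) (pd 0 f x) = E0 at *
    generalize inner ℝ (pd 2 f x) (pd 2 f x) = E2 at *
    field_simp
    linear_combination h1
  · rw [hF.lame_div_zero hx, hB.jacDet_backlund hx, hB.inner_pd_backlund hx,
      hB.inner_pd_backlund hx]
    generalize 1 - backlundScale α fbar f x * q 0 x = s0 at *
    generalize 1 - backlundScale α fbar f x * q 1 x = s1 at *
    generalize 1 - backlundScale α fbar f x * q 2 x = s2 at *
    generalize inner ℝ (pd 1 f x) (pd 1 f x) = E1 at *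
    generalize inner ℝ (pd 2 f x) (pd 2 f x) = E2 at *
    field_simp
    linear_combination h2

theorem isAssociated (hB : BacklundPair U α f fbar q) (hg : IsAssociated U f g) :
    IsAssociated U (backlund α fbar f) (backlund α fbar g) := by
  obtain ⟨p, hp, hpa⟩ := hg
  exact ⟨_, hB.isCombescureWith_backlund hp fun y hy =>
    hpa.traceForm_eq_zero hB.guichard hp hy, hB.isAssociatedData hp hpa⟩

theorem isDual (hB : BacklundPair U α f fbar q) (hd : IsDual U f g d) :
    IsDual U (backlund α fbar f) (backlund α fbar g) (backlund α fbar d) := by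
  obtain ⟨p, hp, hpa, hpd⟩ := hd
  have ht := hB.tos
  have hF := hB.isTriplyOrthogonal
  -- The dual is not Lorentz-orthogonal to `f`, but constancy is all that `pd_backlund` needs.
  have hc : ∀ y ∈ U, traceForm d f y = 2 := by
    intro y hy
    have h0 := hpa.h_one y hy
    have h1 := hpa.h_two y hy
    have htr := hB.guichard.trace_eq y hy
    have l0 := ht.lame_ne_zero hy 0
    have l1 := ht.lame_ne_zero hy 1
    have l2 := ht.lame_ne_zero hy 2
    rw [hpd.traceForm_eq (isCombescureWith_self ht) hy, ← ht.lame_sq hy, ← ht.lame_sq hy,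
      ← ht.lame_sq hy, h0, h1, eps_zero, eps_one, eps_two]
    field_simp
    linear_combination (-1 - p 2 y ^ 2 * lame f 2 y ^ 2) * htr
  refine ⟨_, hB.isCombescureWith_backlund hp fun y hy =>
    hpa.traceForm_eq_zero hB.guichard hp hy, hB.isAssociatedData hp hpa,
    hB.contDiffOn_backlund hpd, fun x hx i => ?_⟩
  rw [(hB.isCombescureWith_backlund hpd hc).pd_eq x hx i]
  congr 1
  have hr := hB.factor_ne_zero hx
  have hs := hB.scale_mul (isCombescureWith_self ht) hx
  rw [(isCombescureWith_self ht).traceForm_eq hB.combescure hx] at hs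
  have hsg := hB.scale_mul hp hx
  rw [hp.traceForm_eq hB.combescure hx] at hsg
  have hsd := hB.scale_mul hpd hx
  rw [hpd.traceForm_eq hB.combescure hx] at hsd
  have hN := hB.traceForm_self hx
  rw [hB.combescure.traceForm_eq hB.combescure hx] at hN
  -- Dividing components by `H_i` makes the vector of `f` equal to `(1, 1, 1)`; `s` is the metric in
  -- these coordinates and `u` its inverse.
  have key := reflected_completeness (s := fun i => eps i * lame f i x ^ 2)
    (u := fun i => eps i / lame f i x ^ 2) (p := fun i => p i x) (q := fun i => q i x)
    (d := fun i => -(p i x) ^ 2 + eps i / lame f i x ^ 2) (N := α ^ 2 * ‖fbar x‖ ^ 2)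
    (cf := backlundScale α fbar f x) (cg := backlundScale α fbar g x)
    (cd := backlundScale α fbar d x)
    (mul_ne_zero (pow_ne_zero 2 hB.alpha_ne_zero) (hB.norm_sq_ne_zero hx))
    (fun i => by
      have hl := ht.lame_ne_zero hx i
      have he : eps i * eps i = 1 := by
        fin_cases i <;> simp [eps_zero, eps_one, eps_two]
      field_simp
      linear_combination he)
    (fun _ => rfl) (fun i j hij => hpa.sub_sq hB.guichard hx hij)
    (by simp only [Fin.sum_univ_three, eps_zero, eps_one, eps_two, ht.lame_sq hx]
        linear_combination -hN)
    (by simp only [Fin.sum_univ_three, eps_zero, eps_one, eps_two, ht.lame_sq hx]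
        linear_combination hs)
    (by simp only [Fin.sum_univ_three, eps_zero, eps_one, eps_two, ht.lame_sq hx]
        linear_combination hsg)
    (by simp only [Fin.sum_univ_three, ht.lame_sq hx] at hsd ⊢
        simp only [eps_zero, eps_one, eps_two] at hsd ⊢
        linear_combination hsd) i
  have hE : lame (backlund α fbar f) i x ^ 2
      = (1 - backlundScale α fbar f x * q i x) ^ 2 * lame f i x ^ 2 := by
    rw [hF.lame_sq hx, hB.inner_pd_backlund hx, ht.lame_sq hx]; ring
  have hri := hr i
  rw [hE, mul_comm (_ ^ 2) (lame f i x ^ 2), ← div_div]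
  generalize 1 - backlundScale α fbar f x * q i x = r at *
  generalize eps i / lame f i x ^ 2 = u at *
  field_simp
  linear_combination key

end BacklundPair

/-! ### Linearity of the transform, and the theorem. -/

theorem lameWrt_add {a b : R3 → R3} (ha : DifferentiableAt ℝ a x) (hb : DifferentiableAt ℝ b x)
    (i : Fin 3) :
    lameWrt f (fun y => a y + b y) i x = lameWrt f a i x + lameWrt f b i x := by
  rw [lameWrt, pd_add_fun ha hb, inner_add_left]; rfl

theorem lameWrt_const_smul {a : R3 → R3} (ha : DifferentiableAt ℝ a x) (c : ℝ) (i : Fin 3) :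
    lameWrt f (fun y => c • a y) i x = c * lameWrt f a i x := by
  rw [lameWrt, pd_const_smul ha, inner_smul_left, conj_trivial]; rfl

theorem backlund_add {a b : R3 → R3} (ha : DifferentiableAt ℝ a x) (hb : DifferentiableAt ℝ b x) :
    backlund α fbar (fun y => a y + b y) x = backlund α fbar a x + backlund α fbar b x := by
  simp only [backlund, backlundPhi, lameWrt_add ha hb]
  module

theorem backlund_const_smul {a : R3 → R3} (ha : DifferentiableAt ℝ a x) (c : ℝ) :
    backlund α fbar (fun y => c • a y) x = c • backlund α fbar a x := by
  simp only [backlund, backlundPhi, lameWrt_const_smul ha]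
  module

theorem backlund_congr (hU : IsOpen U) {a b : R3 → R3} (h : ∀ y ∈ U, a y = b y) (hx : x ∈ U) :
    backlund α fbar a x = backlund α fbar b x := by
  simp only [backlund, backlundPhi, lameWrt, pd_congr hU h hx, h x hx]

end GuichardNets

theorem mainTheorem4 (U : Set R3) (hU : IsOpen U) (hUc : IsConnected U)
    (f : R3 → R3) (hf : IsGuichardNet U f)
    (fhat fstar : ℝ → R3 → R3)
    (hhat : IsAssociatedFamily U f fhat) (hstar : IsDualFamily U f fhat fstar)
    (α : ℝ) (hα : α ≠ 0) (fbar : R3 → R3)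
    (hbar : IsChiSystem U (fun x => α ^ 2 * ‖fbar x‖ ^ 2) fbar)
    (hcomb : IsCombescure U f fbar)
    (hbar0 : ∀ x ∈ U, fbar x ≠ 0)
    (hR : ∀ x ∈ U, jacDet (backlund α fbar f) x ≠ 0) :
    IsGuichardNet U (backlund α fbar f) ∧
      IsAssociatedFamily U (backlund α fbar f) (fun c => backlund α fbar (fhat c)) ∧
      IsDualFamily U (backlund α fbar f) (fun c => backlund α fbar (fhat c))
        (fun c => backlund α fbar (fstar c)) := by
  obtain ⟨q, hq⟩ := hcomb
  have hB : BacklundPair U α f fbar q := ⟨hU, hf, hbar, hq, hα, hbar0, hR⟩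
  have hfd : ∀ x ∈ U, DifferentiableAt ℝ f x := fun x hx =>
    differentiableAt_of_contDiffOn hU hf.triplyOrthogonal.smooth hx
  have hhd : ∀ x ∈ U, DifferentiableAt ℝ (fhat 0) x := fun x hx => by
    obtain ⟨p, hp, -⟩ := hhat.isAssociated 0
    exact differentiableAt_of_contDiffOn hU hp.smooth hx
  have hsd : ∀ x ∈ U, DifferentiableAt ℝ (fstar 0) x := fun x hx => by
    obtain ⟨p, -, -, hp⟩ := hstar.isDual 0
    exact differentiableAt_of_contDiffOn hU hp.smooth hx
  refine ⟨hB.isGuichardNet, ⟨fun c => hB.isAssociated (hhat.isAssociated c), fun c x hx => ?_⟩,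
    ⟨fun c => hB.isDual (hstar.isDual c), fun c x hx => ?_⟩⟩
  · have h := hfd x hx
    rw [backlund_congr hU (hhat.eq_add c) hx, backlund_add (hhd x hx) (h.fun_const_smul c),
      backlund_const_smul h]
  · have h1 := hfd x hx
    have h2 := hhd x hx
    have h3 := hsd x hx
    have heq : ∀ y ∈ U, fstar c y = fstar 0 y + ((-(2 * c)) • fhat 0 y + (-c ^ 2) • f y) := by
      intro y hy
      rw [hstar.eq_sub c y hy]; module
    rw [backlund_congr hU heq hx,
      backlund_add h3 ((h2.fun_const_smul _).fun_add (h1.fun_const_smul _)),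
      backlund_add (h2.fun_const_smul _) (h1.fun_const_smul _), backlund_const_smul h2,
      backlund_const_smul h1]
    module
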